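/- For $c\in\mathbb R$, let $\tilde\alpha_c(t)=(\tilde z(t),\tilde r(t),\theta(t))$ denote the orbit of the geodesic system $$\dot{\tilde z}=\cos\theta,\qquad \dot{\tilde r}=\sin\theta,\qquad \dot\theta=\tilde z\sin\theta+\Big(\frac1{\tilde r}-\tilde r\Big)\cos\theta$$ of the half-plane $\{(\tilde z,\tilde r):\tilde r\ge 0\}$ with the metric $\tilde r^2e^{-(\tilde z^2+\tilde r^2)}(d\tilde z^2+d\tilde r^2)$ that starts at $\tilde\alpha_c(0)=(c,0,\pi/2)$; that is, $\tilde\alpha_c$ is continuous on its interval $[0,T]$, and $\tilde r>0$ and the equations hold for $t>0$. We say that $\tilde\alpha_c$ hits the $\tilde r$-axis at the angle $\theta_0$ if there is a $T>0$ such that $\tilde z>0$ on $[0,T)$, $\tilde z(T)=0$ and $\theta(T)=\theta_0$. There are constants $\delta_0>0$ and $C>0$ with the following properties. For every $c\in(\sqrt2-\delta_0,\sqrt2+\delta_0)$ the orbit $\tilde\alpha_c$ exists until it hits the $\tilde r$-axis, and it is unique (two such orbits with the same $c$ agree on their common interval). Moreover, for every $\delta_c\in(0,\delta_0]$ there is a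 $\delta_\theta>0$ such that for every $\theta_0\in(\pi-\delta_\theta,\pi+\delta_\theta)$ there is a unique $c_0\in(\sqrt2-\delta_c,\sqrt2+\delta_c)$ for which the orbit $\tilde\alpha_{c_0}$ hits the $\tilde r$-axis at the angle $\theta_0$, and $$|c_0-\sqrt2|\le C\,|\theta_0-\pi|.$$ -/

import Mathlib

/-- `(z, r, θ)` is, on the time interval `[0, T]`, the orbit issued from the point `(c, 0, π/2)` of
the arc-length geodesic system of the half-plane `{(z, r) | 0 ≤ r}` with the metric
`r² exp(-(z² + r²)) (dz² + dr²)`: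
`z' = cos θ`, `r' = sin θ`, `θ' = z sin θ + (1 / r - r) cos θ`.
The system is singular on `r = 0`, so that the equations are imposed for `0 < t < T`, where `r` is
positive, and the initial values are attained continuously.
The profile curve `t ↦ (z t, r t)` generates a rotationally symmetric self-shrinking cap. -/
structure IsCapOrbit (c T : ℝ) (z r θ : ℝ → ℝ) : Prop where
  z_zero : z 0 = c
  r_zero : r 0 = 0
  theta_zero : θ 0 = Real.pi / 2
  continuousOn_z : ContinuousOn z (Set.Icc 0 T)
  continuousOn_r : ContinuousOn r (Set.Icc 0 T)
  continuousOn_theta : ContinuousOn θ (Set.Icc 0 T)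
  r_pos : ∀ t ∈ Set.Ioc 0 T, 0 < r t
  deriv_z : ∀ t ∈ Set.Ioo 0 T, HasDerivAt z (Real.cos (θ t)) t
  deriv_r : ∀ t ∈ Set.Ioo 0 T, HasDerivAt r (Real.sin (θ t)) t
  deriv_theta : ∀ t ∈ Set.Ioo 0 T,
    HasDerivAt θ (z t * Real.sin (θ t) + (1 / r t - r t) * Real.cos (θ t)) t

/-- The orbit issued from `(c, 0, π/2)` hits the `r`-axis `{z = 0}` (for the first time, that is,
it leaves the open right half `{0 < z}` of the half-plane) with tangent angle `θ₀`. -/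
def HitsRAxisAtAngle (c θ₀ : ℝ) : Prop :=
  ∃ (T : ℝ) (z r θ : ℝ → ℝ), 0 < T ∧ IsCapOrbit c T z r θ ∧
    (∀ t ∈ Set.Ico 0 T, 0 < z t) ∧ z T = 0 ∧ θ T = θ₀

/-! Write the curve as a polar graph z = ρ cos φ, r = ρ sin φ and put p = ρ'/ρ. The geodesic system
becomes p' = (1 + p²)(2 - ρ² - p cot φ), with ρ(0) = c, p(0) = 0. The axis is met at φ = π/2 with
angle π - arctan p(π/2), and ρ = √2, p = 0 is the round solution. With x = 1 - cos φ, p = y sin φ, R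
= ρ²/2, integration from x = 0 removes the singularity: the equations say that `profileMap` takes
(y, R) to (0, c²/2) in C([0, 1])². The inverse function theorem applies at (0, 1): eliminating y
from the linearization leaves 1 + 4N with N = `legendreInv`, and N is of Volterra type
(`norm_legendreInv_pow_le`), so 1 + 4N is invertible. This gives orbits whose hitting angle Θ(c) is
strictly differentiable at √2. The derivative of y(1) in b = c²/2 is -2 ∫₀¹ u, where u = 1 - 4Nu,
that is, (x(2 - x)u')' + 4u = 0 and u(0) = 1. Comparison with an explicit quadratic shows that ∫ u >
0 (`radialMean_one_pos`), hence Θ'(√2) ≠ 0. So Θ is open at √2 and expands distances near it, which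
gives c₀, its uniqueness and the linear estimate. Uniqueness of c₀ among all orbits also needs that
c determines the orbit, in spite of the singular initial point (`IsCapOrbit.unique`): the momentum r
cos θ has a derivative free of 1/r, which gives a contraction estimate for short times; after that
the system is Lipschitz. -/

open scoped unitInterval Topology

/-! ### The radial mean and the inverse Legendre operator -/

/-- The operator `f ↦ (x ↦ ∫₀¹ f (x s) ds)` on `C([0, 1])`. -/
noncomputable def radialMean : C(I, ℝ) →L[ℝ] C(I, ℝ) :=
  LinearMap.mkContinuous
    { toFun := fun f =>
        { toFun := fun x => ∫ s in (0 : ℝ)..1, Set.IccExtend zero_le_one f ((x : ℝ) * s)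
          continuous_toFun := by
            apply intervalIntegral.continuous_parametric_intervalIntegral_of_continuous'
            have := f.continuous.Icc_extend' (h := zero_le_one (α := ℝ))
            fun_prop }
      map_add' := fun f g => by
        ext x
        have hf := f.continuous.Icc_extend' (h := zero_le_one (α := ℝ))
        have hg := g.continuous.Icc_extend' (h := zero_le_one (α := ℝ))
        simp only [ContinuousMap.coe_mk, ContinuousMap.add_apply]
        rw [← intervalIntegral.integral_add]
        · rfl
        · exact (hf.comp (by fun_prop : Continuous fun s : ℝ => (x : ℝ) * s)).intervalIntegrable _ _
        · exact (hg.comp (by fun_prop : Continuous fun s : ℝ => (x : ℝ) * s)).intervalIntegrable _ _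
      map_smul' := fun c f => by
        ext x
        simp only [ContinuousMap.coe_mk, ContinuousMap.smul_apply, RingHom.id_apply, smul_eq_mul]
        rw [← intervalIntegral.integral_const_mul]
        rfl } 1 (fun f => by
      rw [one_mul, ContinuousMap.norm_le _ (norm_nonneg _)]
      intro x
      have := intervalIntegral.norm_integral_le_of_norm_le_const (a := 0) (b := 1)
        (f := fun s => Set.IccExtend zero_le_one f ((x : ℝ) * s)) (C := ‖f‖)
        (fun s _ => f.norm_coe_le_norm _)
      simpa using this)

theorem radialMean_apply (f : C(I, ℝ)) (x : I) :
    radialMean f x = ∫ s in (0 : ℝ)..1, Set.IccExtend zero_le_one f ((x : ℝ) * s) := rfl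

theorem radialMean_eq_of_forall {f : C(I, ℝ)} {g : ℝ → ℝ} (h : ∀ x : I, f x = g x) (x : I) :
    radialMean f x = ∫ s in (0 : ℝ)..1, g ((x : ℝ) * s) := by
  rw [radialMean_apply]
  apply intervalIntegral.integral_congr
  intro s hs
  rw [Set.uIcc_of_le zero_le_one] at hs
  have hxs : (x : ℝ) * s ∈ Set.Icc (0 : ℝ) 1 := unitInterval.mul_mem x.2 hs
  simp only
  rw [Set.IccExtend_of_mem _ _ hxs, h]

/-- The substitution s ↦ x s. It turns an integral equation written with the mean into one with a
primitive, which can be differentiated. -/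
theorem mul_radialMean (f : C(I, ℝ)) (x : I) :
    (x : ℝ) * radialMean f x = ∫ s in (0 : ℝ)..x, Set.IccExtend zero_le_one f s := by
  rw [radialMean_apply]
  have := intervalIntegral.smul_integral_comp_mul_left (a := 0) (b := 1)
    (Set.IccExtend zero_le_one f) (x : ℝ)
  simpa only [smul_eq_mul, mul_zero, mul_one] using this

theorem radialMean_mono {f g : C(I, ℝ)} (h : f ≤ g) : radialMean f ≤ radialMean g := by
  intro x
  change radialMean f x ≤ radialMean g x
  rw [radialMean_apply, radialMean_apply]
  have hf := f.continuous.Icc_extend' (h := zero_le_one (α := ℝ))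
  have hg := g.continuous.Icc_extend' (h := zero_le_one (α := ℝ))
  apply intervalIntegral.integral_mono zero_le_one
  · exact (hf.comp (by fun_prop : Continuous fun s : ℝ => (x : ℝ) * s)).intervalIntegrable _ _
  · exact (hg.comp (by fun_prop : Continuous fun s : ℝ => (x : ℝ) * s)).intervalIntegrable _ _
  · exact fun s => h _

/-- The coordinate function of the unit interval. -/
def unitCoord : C(I, ℝ) := ⟨fun x => x, continuous_subtype_val⟩

@[simp] theorem unitCoord_apply (x : I) : unitCoord x = x := rfl

/-- The function `x ↦ 1 / (2 - x)` on the unit interval. -/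
noncomputable def unitWeight : C(I, ℝ) :=
  ⟨fun x => (2 - (x : ℝ))⁻¹, by
    refine Continuous.inv₀ (by fun_prop) fun x => ?_
    have := x.2.2
    linarith⟩

@[simp] theorem unitWeight_apply (x : I) : unitWeight x = (2 - (x : ℝ))⁻¹ := rfl

theorem unitWeight_nonneg (x : I) : 0 ≤ unitWeight x := by
  have := x.2.2
  exact inv_nonneg.2 (by linarith)

theorem unitWeight_le_one (x : I) : unitWeight x ≤ 1 := by
  have := x.2.2
  exact inv_le_one_of_one_le₀ (by linarith)

/-- The inverse of the operator `f ↦ (x (2 - x) f')'` with zero value at `0`. -/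
noncomputable def legendreInv : C(I, ℝ) →L[ℝ] C(I, ℝ) :=
  ContinuousLinearMap.mul ℝ _ unitCoord ∘L radialMean ∘L
    ContinuousLinearMap.mul ℝ _ unitWeight ∘L radialMean

theorem legendreInv_apply (f : C(I, ℝ)) :
    legendreInv f = unitCoord * radialMean (unitWeight * radialMean f) := rfl

theorem legendreInv_nonneg {f : C(I, ℝ)} (h : 0 ≤ f) : 0 ≤ legendreInv f := by
  have h1 : 0 ≤ radialMean f := by simpa using radialMean_mono h
  have h2 : (0 : C(I, ℝ)) ≤ unitWeight * radialMean f :=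
    fun x => mul_nonneg (unitWeight_nonneg x) (h1 x)
  have h3 : 0 ≤ radialMean (unitWeight * radialMean f) := by simpa using radialMean_mono h2
  exact fun x => mul_nonneg x.2.1 (h3 x)

theorem abs_radialMean_le {f : C(I, ℝ)} {K : ℝ} {n : ℕ} (h : ∀ x, |f x| ≤ K * (x : ℝ) ^ n)
    (x : I) : |radialMean f x| ≤ K * (x : ℝ) ^ n / (n + 1) := by
  have h1 : radialMean f x ≤ K * (x : ℝ) ^ n / (n + 1) ∧
      -(K * (x : ℝ) ^ n / (n + 1)) ≤ radialMean f x := by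
    have e : radialMean (K • unitCoord ^ n) x = K * (x : ℝ) ^ n / (n + 1) := by
      rw [radialMean_eq_of_forall (g := fun s => K * s ^ n) (fun x => by simp)]
      simp only [mul_pow]
      rw [intervalIntegral.integral_const_mul, intervalIntegral.integral_const_mul, integral_pow]
      simp
      ring
    rw [← e]
    constructor
    · exact radialMean_mono (fun x => by simpa using (abs_le.1 (h x)).2) x
    · have := radialMean_mono (f := -(K • unitCoord ^ n)) (g := f)
        (fun x => by simpa using (abs_le.1 (h x)).1) x
      simpa using this
  exact abs_le.2 ⟨h1.2, h1.1⟩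

/-- Each of the two means divides the coefficient of xⁿ by n + 1, the weight is at most 1, and the
factor x raises the degree. Iteration produces the square of a factorial. -/
theorem abs_legendreInv_le {f : C(I, ℝ)} {K : ℝ} {n : ℕ}
    (h : ∀ x, |f x| ≤ K * (x : ℝ) ^ n) (x : I) :
    |legendreInv f x| ≤ K / (n + 1) ^ 2 * (x : ℝ) ^ (n + 1) := by
  have h1 : ∀ x, |(unitWeight * radialMean f) x| ≤ K / (n + 1) * (x : ℝ) ^ n := by
    intro x
    rw [ContinuousMap.mul_apply, abs_mul, abs_of_nonneg (unitWeight_nonneg x)]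
    calc _ ≤ 1 * |radialMean f x| :=
          mul_le_mul_of_nonneg_right (unitWeight_le_one x) (abs_nonneg _)
      _ ≤ _ := by
          rw [one_mul, div_mul_eq_mul_div]
          exact abs_radialMean_le h x
  have h4 := abs_radialMean_le h1 x
  rw [legendreInv_apply, ContinuousMap.mul_apply, unitCoord_apply, abs_mul, abs_of_nonneg x.2.1]
  calc _ ≤ (x : ℝ) * (K / (n + 1) * (x : ℝ) ^ n / (n + 1)) := mul_le_mul_of_nonneg_left h4 x.2.1
    _ = _ := by
      field_simp
      ring

theorem abs_legendreInv_pow_le (f : C(I, ℝ)) (n : ℕ) (x : I) :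
    |(legendreInv ^ n) f x| ≤ ‖f‖ / (n.factorial : ℝ) ^ 2 * (x : ℝ) ^ n := by
  induction n generalizing x with
  | zero => simpa using f.norm_coe_le_norm x
  | succ n ih =>
    rw [pow_succ', mul_apply_eq_comp]
    refine (abs_legendreInv_le ih x).trans (le_of_eq ?_)
    rw [Nat.factorial_succ]
    push_cast
    field_simp

theorem norm_legendreInv_pow_le (n : ℕ) : ‖legendreInv ^ n‖ ≤ 1 / n.factorial := by
  refine ContinuousLinearMap.opNorm_le_bound _ (by positivity) fun f => ?_
  rw [ContinuousMap.norm_le _ (by positivity)]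
  intro x
  refine (abs_legendreInv_pow_le f n x).trans ?_
  have h1 : (x : ℝ) ^ n ≤ 1 := pow_le_one₀ x.2.1 x.2.2
  have h2 : (1 : ℝ) ≤ n.factorial := by exact_mod_cast n.factorial_pos
  calc _ ≤ ‖f‖ / (n.factorial : ℝ) ^ 2 * 1 := mul_le_mul_of_nonneg_left h1 (by positivity)
    _ ≤ ‖f‖ / n.factorial := by
        rw [mul_one]
        exact div_le_div_of_nonneg_left (norm_nonneg f) (by positivity) (by nlinarith)
    _ = _ := by ring

/-! ### Operators with factorially decaying powers -/

section FactorialDecay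

variable {E : Type*} [NormedAddCommGroup E] [NormedSpace ℝ E] {B : E →L[ℝ] E}

theorem tendsto_norm_pow_smul_of_norm_pow_le (hB : ∀ n : ℕ, ‖B ^ n‖ ≤ 1 / n.factorial) (K : ℝ) :
    Filter.Tendsto (fun n : ℕ => ‖(K • B) ^ n‖) Filter.atTop (𝓝 0) := by
  refine squeeze_zero (fun n => norm_nonneg ((K • B) ^ n)) (fun n => ?_)
    (FloorSemiring.tendsto_pow_div_factorial_atTop |K|)
  rw [smul_pow, norm_smul, norm_pow, Real.norm_eq_abs]
  calc _ ≤ |K| ^ n * (1 / n.factorial) := mul_le_mul_of_nonneg_left (hB n) (by positivity)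
    _ = _ := by ring

/-- Some power of K B has norm less than 1, so 1 - (K B)ⁿ is a unit; 1 - K B is one of its two
commuting factors. No smallness of K is needed. -/
theorem isUnit_one_sub_smul_of_norm_pow_le [CompleteSpace E]
    (hB : ∀ n : ℕ, ‖B ^ n‖ ≤ 1 / n.factorial) (K : ℝ) : IsUnit (1 - K • B) := by
  obtain ⟨n, hn⟩ := ((tendsto_norm_pow_smul_of_norm_pow_le hB K).eventually_lt_const
    zero_lt_one).exists
  have h : IsUnit (1 - (K • B) ^ n) := isUnit_one_sub_of_norm_lt_one hn
  have hc : Commute (1 - K • B) (∑ i ∈ Finset.range n, (K • B) ^ i) :=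
    (mul_neg_geom_sum _ n).trans (geom_sum_mul_neg _ n).symm
  rw [← mul_neg_geom_sum, hc.isUnit_mul_iff] at h
  exact h.1

theorem smul_pow_two_mul (K : ℝ) (n : ℕ) : (K • B) ^ (2 * n) = (K ^ 2 • B ^ 2) ^ n := by
  rw [pow_mul, smul_pow]

end FactorialDecay

/-! ### Sign of the linearized solution -/

theorem integral_quadratic_unit (a b c : ℝ) :
    ∫ s in (0 : ℝ)..1, (a + b * s + c * s ^ 2) = a + b / 2 + c / 3 := by
  have h : ∀ s ∈ Set.uIcc (0 : ℝ) 1, HasDerivAt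
      (fun s => a * s + b * s ^ 2 / 2 + c * s ^ 3 / 3) (a + b * s + c * s ^ 2) s := by
    intro s _
    have := (((hasDerivAt_id s).const_mul a).add
      (((hasDerivAt_pow 2 s).const_mul b).div_const 2)).add
      (((hasDerivAt_pow 3 s).const_mul c).div_const 3)
    refine this.congr_deriv ?_
    norm_num
    ring
  rw [intervalIntegral.integral_eq_sub_of_hasDerivAt h
    (Continuous.intervalIntegrable (by fun_prop) _ _)]
  norm_num

/-- A solution of `R = 1 - 4 B R` has positive integral, `B` being `legendreInv`. -/
theorem radialMean_one_pos {u : C(I, ℝ)} (hu : u = 1 - (4 : ℝ) • legendreInv u) :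
    0 < radialMean u 1 := by
  -- The quadratic is chosen so that 4q + x² has radial mean (2 - x)²: the weight cancels and N(4q +
  -- x²) is explicit. Thus q solves the equation up to the error -N x², and ∫ q = 1/6.
  set q : C(I, ℝ) := 1 - (2 : ℝ) • unitCoord + (1 / 2 : ℝ) • unitCoord ^ 2 with hq
  have hq' : q = 1 - (4 : ℝ) • legendreInv q - legendreInv (unitCoord ^ 2) := by
    have h1 : legendreInv ((4 : ℝ) • q + unitCoord ^ 2) =
        (2 : ℝ) • unitCoord - (1 / 2 : ℝ) • unitCoord ^ 2 := by
      have h2 : unitWeight * radialMean ((4 : ℝ) • q + unitCoord ^ 2) =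
          (2 : ℝ) • 1 - unitCoord := by
        ext x
        rw [ContinuousMap.mul_apply,
          radialMean_eq_of_forall (g := fun s => 4 - 8 * s + 3 * s ^ 2)
            (fun x => by simp [hq]; ring)]
        have : ∫ s in (0 : ℝ)..1, (4 - 8 * ((x : ℝ) * s) + 3 * ((x : ℝ) * s) ^ 2)
            = (2 - (x : ℝ)) ^ 2 := by
          have : ∀ s : ℝ, (4 - 8 * ((x : ℝ) * s) + 3 * ((x : ℝ) * s) ^ 2) =
            4 + (-8 * x) * s + (3 * x ^ 2) * s ^ 2 := fun s => by ring
          simp only [this]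
          rw [integral_quadratic_unit]
          ring
        rw [this]
        have hx : (2 - (x : ℝ)) ≠ 0 := by linarith [x.2.2]
        simp
        field_simp
      rw [legendreInv_apply, h2]
      ext x
      rw [ContinuousMap.mul_apply,
          radialMean_eq_of_forall (g := fun s => 2 - s) (fun x => by simp)]
      have : ∀ s : ℝ, 2 - (x : ℝ) * s = 2 + (-x) * s + 0 * s ^ 2 := fun s => by ring
      simp only [this]
      rw [integral_quadratic_unit]
      simp
      ring
    rw [map_add, map_smul] at h1
    rw [sub_sub, h1, hq]
    abel
  set e := u - q with he
  set f := legendreInv (unitCoord ^ 2 - (4 : ℝ) • legendreInv (unitCoord ^ 2)) with hf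
  have he1 : e = legendreInv (unitCoord ^ 2) - (4 : ℝ) • legendreInv e := by
    rw [he, map_sub, smul_sub]
    nth_rw 1 [hu, hq']
    abel
  -- Inserting the equation for e into itself replaces -4N, which reverses signs, by the positive
  -- operator 16N².
  have he2 : e = f + ((16 : ℝ) • legendreInv ^ 2) e := by
    have h1 : legendreInv e =
        legendreInv (legendreInv (unitCoord ^ 2)) - (4 : ℝ) • legendreInv (legendreInv e) := by
      nth_rw 1 [he1]
      rw [map_sub, map_smul]
    have h2 : ((16 : ℝ) • legendreInv ^ 2) e = (16 : ℝ) • legendreInv (legendreInv e) := by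
      rw [pow_two]
      rfl
    rw [h2, hf, map_sub, map_smul]
    calc e = legendreInv (unitCoord ^ 2) - (4 : ℝ) • (legendreInv (legendreInv (unitCoord ^ 2)) -
          (4 : ℝ) • legendreInv (legendreInv e)) := by
          rw [← h1]
          exact he1
      _ = _ := by module
  -- N x² ≤ x³/9, hence x² - 4 N x² ≥ x² - 4x³/9 ≥ 0.
  have hf0 : 0 ≤ f := by
    apply legendreInv_nonneg
    intro x
    have h1 := abs_legendreInv_le (f := unitCoord ^ 2) (K := 1) (n := 2)
      (fun x => by simp) x
    have h2 := (abs_le.1 h1).2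
    have h3 := x.2.1
    have h4 := x.2.2
    change 0 ≤ (x : ℝ) ^ 2 - 4 * legendreInv (unitCoord ^ 2) x
    norm_num at h2
    nlinarith [pow_nonneg h3 2, mul_nonneg (pow_nonneg h3 2) (sub_nonneg.2 h4)]
  have hpos : ∀ g : C(I, ℝ), 0 ≤ g → ∀ n : ℕ, 0 ≤ (((16 : ℝ) • legendreInv ^ 2) ^ n) g := by
    intro g hg n
    induction n with
    | zero => simpa using hg
    | succ n ih =>
      rw [pow_succ', mul_apply_eq_comp]
      have h := legendreInv_nonneg (legendreInv_nonneg ih)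
      exact fun x => mul_nonneg (by norm_num) (h x)
  have hle : ∀ n : ℕ, (((16 : ℝ) • legendreInv ^ 2) ^ n) e ≤ e := by
    intro n
    induction n with
    | zero => simp
    | succ n ih =>
      have h1 : ((16 : ℝ) • legendreInv ^ 2) e = e - f := eq_sub_of_add_eq' he2.symm
      rw [pow_succ, mul_apply_eq_comp, h1, map_sub]
      exact (sub_le_self _ (hpos f hf0 n)).trans ih
  -- By `hle`, e dominates (16N²)ⁿ e, which tends to 0 in norm.
  have he0 : 0 ≤ e := by
    intro x
    have h1 : Filter.Tendsto (fun n : ℕ => -(‖((-4 : ℝ) • legendreInv) ^ (2 * n)‖ * ‖e‖))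
        Filter.atTop (𝓝 0) := by
      have := ((tendsto_norm_pow_smul_of_norm_pow_le norm_legendreInv_pow_le (-4)).comp
        (Filter.tendsto_id.const_mul_atTop' (two_pos : 0 < 2))).mul_const ‖e‖
      have h := this.neg
      rw [zero_mul, neg_zero] at h
      exact h
    change 0 ≤ e x
    refine le_of_tendsto' h1 fun n => ?_
    have h2 : ((-4 : ℝ) • legendreInv) ^ (2 * n) = ((16 : ℝ) • legendreInv ^ 2) ^ n := by
      rw [smul_pow_two_mul]
      norm_num
    rw [h2]
    refine le_trans ?_ (hle n x)
    have h3 := ((((16 : ℝ) • legendreInv ^ 2) ^ n) e).norm_coe_le_norm x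
    have h4 := (((16 : ℝ) • legendreInv ^ 2) ^ n).le_opNorm e
    exact neg_le_of_abs_le (h3.trans h4)
  have h1 : radialMean q 1 = 1 / 6 := by
    rw [radialMean_eq_of_forall (g := fun s => 1 + (-2) * s + (1 / 2) * s ^ 2)
      (fun x => by simp [hq]; ring)]
    simp only [Set.Icc.coe_one, one_mul]
    rw [integral_quadratic_unit]
    norm_num
  have h2 : radialMean q 1 ≤ radialMean u 1 := radialMean_mono (sub_nonneg.1 he0) 1
  linarith

/-! ### The profile equation and the inverse function theorem -/

section ProfileMap

variable {E : Type*} [NormedCommRing E] [NormedAlgebra ℝ E]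

/-- The map whose fibre over `(0, b)` consists of the solutions of the profile equation; the
parameters are an averaging operator `A`, a weight `w` and a coordinate `X`. -/
noncomputable def profileMap (A : E →L[ℝ] E) (w X : E) (u : E × E) : E × E :=
  (u.1 - w * A ((2 : ℝ) • ((1 + X * (2 - X) * u.1 ^ 2) * (1 - u.2)) -
      (1 - X) * (X * (2 - X)) * u.1 ^ 3),
    u.2 - X * A ((2 : ℝ) • (u.1 * u.2)))

/-- The linearization of `profileMap` at `(0, 1)`. -/
noncomputable def profileDeriv (A : E →L[ℝ] E) (w X : E) : E × E →L[ℝ] E × E :=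
  (ContinuousLinearMap.fst ℝ E E +
      (2 : ℝ) • (ContinuousLinearMap.mul ℝ E w ∘L A ∘L ContinuousLinearMap.snd ℝ E E)).prod
    (ContinuousLinearMap.snd ℝ E E -
      (2 : ℝ) • (ContinuousLinearMap.mul ℝ E X ∘L A ∘L ContinuousLinearMap.fst ℝ E E))

theorem profileDeriv_apply (A : E →L[ℝ] E) (w X : E) (u : E × E) :
    profileDeriv A w X u = (u.1 + (2 : ℝ) • (w * A u.2), u.2 - (2 : ℝ) • (X * A u.1)) := rfl

theorem profileMap_zero_one (A : E →L[ℝ] E) (w X : E) : profileMap A w X (0, 1) = (0, 1) := by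
  simp [profileMap]

theorem hasStrictFDerivAt_profileMap (A : E →L[ℝ] E) (w X : E) :
    HasStrictFDerivAt (profileMap A w X) (profileDeriv A w X) (0, 1) := by
  have h1 : HasStrictFDerivAt (fun u : E × E => u.1) (ContinuousLinearMap.fst ℝ E E) (0, 1) :=
    hasStrictFDerivAt_fst
  have h2 : HasStrictFDerivAt (fun u : E × E => u.2) (ContinuousLinearMap.snd ℝ E E) (0, 1) :=
    hasStrictFDerivAt_snd
  have h3 := ((h1.pow 2).const_mul (X * (2 - X))).const_add 1
  have h4 := (h3.mul (h2.const_sub 1)).const_smul (2 : ℝ)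
  have h5 := h4.sub ((h1.pow 3).const_mul ((1 - X) * (X * (2 - X))))
  have h6 := h1.sub ((A.hasStrictFDerivAt.comp _ h5).const_mul w)
  have h7 := h2.sub ((A.hasStrictFDerivAt.comp _ ((h1.mul h2).const_smul (2 : ℝ))).const_mul X)
  refine (h6.prodMk h7).congr_fderiv ?_
  ext u <;> simp [profileDeriv_apply]

/-- Block elimination: the first component gives y = v₁ - 2 w A σ, and then the second reads (1 + 4
X A w A) σ = v₂ + 2 X A v₁, solvable by hypothesis. -/
theorem exists_equiv_profileDeriv {A : E →L[ℝ] E} {w X : E}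
    (hU : IsUnit (1 - (-4 : ℝ) • (ContinuousLinearMap.mul ℝ E X ∘L A ∘L
      ContinuousLinearMap.mul ℝ E w ∘L A))) :
    ∃ L : (E × E) ≃L[ℝ] (E × E), (L : E × E →L[ℝ] E × E) = profileDeriv A w X := by
  set N := ContinuousLinearMap.mul ℝ E X ∘L A ∘L ContinuousLinearMap.mul ℝ E w ∘L A with hN
  have hNa : ∀ f, N f = X * A (w * A f) := fun f => rfl
  obtain ⟨U, hU⟩ := hU
  have hUa : ∀ f, (U : E →L[ℝ] E) f = f + (4 : ℝ) • (X * A (w * A f)) := fun f => by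
    rw [hU, ← hNa]
    simp
  have hU1 : ∀ f, (U : E →L[ℝ] E) ((↑U⁻¹ : E →L[ℝ] E) f) = f := fun f =>
    DFunLike.congr_fun U.mul_inv f
  have hU2 : ∀ f, (↑U⁻¹ : E →L[ℝ] E) ((U : E →L[ℝ] E) f) = f := fun f =>
    DFunLike.congr_fun U.inv_mul f
  let J : E × E →L[ℝ] E := (↑U⁻¹ : E →L[ℝ] E) ∘L (ContinuousLinearMap.snd ℝ E E +
    (2 : ℝ) • (ContinuousLinearMap.mul ℝ E X ∘L A ∘L ContinuousLinearMap.fst ℝ E E))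
  have hJ : ∀ v, J v = (↑U⁻¹ : E →L[ℝ] E) (v.2 + (2 : ℝ) • (X * A v.1)) := fun v => rfl
  let Li : E × E →L[ℝ] E × E :=
    (ContinuousLinearMap.fst ℝ E E - (2 : ℝ) • (ContinuousLinearMap.mul ℝ E w ∘L A ∘L J)).prod J
  have hLi : ∀ v, Li v = (v.1 - (2 : ℝ) • (w * A (J v)), J v) := fun v => rfl
  refine ⟨ContinuousLinearEquiv.equivOfInverse (profileDeriv A w X) Li (fun u => ?_)
    (fun v => ?_), rfl⟩
  · have h1 : J (profileDeriv A w X u) = u.2 := by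
      rw [hJ, profileDeriv_apply, ← hU2 u.2]
      congr 1
      rw [hU2, hUa]
      simp only [map_add, map_smul, mul_add, mul_smul_comm]
      module
    rw [hLi, h1, profileDeriv_apply]
    simp
  · have h1 : J v + (4 : ℝ) • (X * A (w * A (J v))) = v.2 + (2 : ℝ) • (X * A v.1) := by
      rw [← hUa, hJ, hU1]
    rw [profileDeriv_apply, hLi]
    ext
    · simp
    · simp only [map_sub, map_smul, mul_sub, mul_smul_comm]
      rw [← sub_eq_zero] at h1 ⊢
      rw [← h1]
      module

/-- S is the local inverse along the line b ↦ (0, b), and v = S'(1) is the preimage of (0, 1) under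
the linearization. The last two equations are this fact with the first component eliminated. -/
theorem exists_profileMap_inverse [CompleteSpace E] {A : E →L[ℝ] E} {w X : E}
    (hU : IsUnit (1 - (-4 : ℝ) • (ContinuousLinearMap.mul ℝ E X ∘L A ∘L
      ContinuousLinearMap.mul ℝ E w ∘L A))) :
    ∃ (S : ℝ → E × E) (v : E × E), S 1 = (0, 1) ∧ HasStrictDerivAt S v 1 ∧
      (∀ᶠ b in 𝓝 (1 : ℝ), profileMap A w X (S b) = (0, b • 1)) ∧
      v.2 = 1 - (4 : ℝ) • (X * A (w * A v.2)) ∧ v.1 = -((2 : ℝ) • (w * A v.2)) := by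
  obtain ⟨L, hL⟩ := exists_equiv_profileDeriv hU
  have hΦ := hasStrictFDerivAt_profileMap A w X
  rw [← hL] at hΦ
  have hι : HasStrictDerivAt (fun b : ℝ => ((0 : E), b • (1 : E))) ((0 : E), (1 : E)) 1 := by
    have := (hasStrictDerivAt_const (1 : ℝ) (0 : E)).prodMk
      ((hasStrictDerivAt_id (1 : ℝ)).smul_const (1 : E))
    simpa using this
  have hι1 : ((0 : E), (1 : ℝ) • (1 : E)) = profileMap A w X (0, 1) := by
    rw [profileMap_zero_one, one_smul]
  have hg := hΦ.to_localInverse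
  rw [← hι1] at hg
  have hSd := HasStrictFDerivAt.comp_hasStrictDerivAt (1 : ℝ) hg hι
  refine ⟨fun b => hΦ.localInverse _ _ _ (0, b • 1), L.symm (0, 1), ?_, hSd, ?_, ?_⟩
  · simp only [hι1]
    exact hΦ.localInverse_apply_image
  · have h1 := hΦ.eventually_right_inverse
    rw [← hι1] at h1
    exact hι.hasDerivAt.continuousAt.eventually h1
  · have h1 : profileDeriv A w X (L.symm (0, 1)) = (0, 1) := by
      rw [← hL]
      exact L.apply_symm_apply _
    rw [profileDeriv_apply, Prod.mk.injEq] at h1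
    have h2 := eq_neg_of_add_eq_zero_left h1.1
    refine ⟨?_, h2⟩
    have h3 := h1.2
    rw [h2] at h3
    simp only [map_neg, map_smul, mul_neg, mul_smul_comm, smul_neg, sub_neg_eq_add, smul_smul] at h3
    norm_num at h3
    exact eq_sub_of_add_eq h3

end ProfileMap

theorem exists_profile_family :
    ∃ (S : ℝ → C(I, ℝ) × C(I, ℝ)) (d : ℝ), S 1 = (0, 1) ∧ d ≠ 0 ∧
      HasStrictDerivAt (fun b => (S b).1 1) d 1 ∧
      (∀ᶠ b in 𝓝 (1 : ℝ), profileMap radialMean unitWeight unitCoord (S b) = (0, b • 1) ∧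
        ∀ x, 1 / 2 ≤ (S b).2 x) := by
  have hU := isUnit_one_sub_smul_of_norm_pow_le norm_legendreInv_pow_le (-4)
  obtain ⟨S, v, hS1, hSd, hS, hv2, hv1⟩ :=
    exists_profileMap_inverse (A := radialMean) (w := unitWeight) (X := unitCoord) hU
  have hpos := radialMean_one_pos hv2
  refine ⟨S, v.1 1, hS1, ?_, ?_, hS.and ?_⟩
  · rw [hv1]
    have : (-((2 : ℝ) • (unitWeight * radialMean v.2))) 1 = -(2 * radialMean v.2 1) := by
      simp
      norm_num
    rw [this]
    linarith
  · exact ((ContinuousMap.evalCLM ℝ (1 : I)).comp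
      (ContinuousLinearMap.fst ℝ C(I, ℝ) C(I, ℝ))).hasStrictFDerivAt.comp_hasStrictDerivAt 1 hSd
  · have h1 : Filter.Tendsto (fun b => (S b).2) (𝓝 1) (𝓝 1) := by
      have := (continuous_snd.continuousAt.comp hSd.hasDerivAt.continuousAt).tendsto
      simpa [Function.comp_def, hS1] using this
    -- Radius 1/2 around R = 1 keeps R ≥ 1/2, so that ρ = √(2R) ≥ 1.
    filter_upwards [h1 (Metric.ball_mem_nhds 1 one_half_pos)] with b hb x
    have h2 : ‖(S b).2 - 1‖ < 1 / 2 := by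
      rw [← dist_eq_norm]
      exact hb
    have h3 := (((S b).2 - 1).norm_coe_le_norm x).trans h2.le
    have h4 := (abs_le.1 h3).1
    simp only [ContinuousMap.sub_apply, ContinuousMap.one_apply] at h4
    linarith

/-! ### From profiles to orbits -/

/-- A curve given in polar coordinates by the radius `ρ φ`, with logarithmic derivative `p`,
generates a cap orbit after reparametrization by arc length. -/
theorem hitsRAxisAtAngle_of_polar {c : ℝ} {ρ p : ℝ → ℝ} (hρ : Continuous ρ) (hp : Continuous p)
    (hρ1 : ∀ φ, 1 ≤ ρ φ) (hρ0 : ρ 0 = c) (hp0 : p 0 = 0)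
    (hρ' : ∀ φ ∈ Set.Ioo 0 (Real.pi / 2), HasDerivAt ρ (ρ φ * p φ) φ)
    (hp' : ∀ φ ∈ Set.Ioo 0 (Real.pi / 2), HasDerivAt p
      ((1 + p φ ^ 2) * (2 - ρ φ ^ 2 - Real.cos φ / Real.sin φ * p φ)) φ) :
    HitsRAxisAtAngle c (Real.pi - Real.arctan (p (Real.pi / 2))) := by
  -- The speed of the curve with respect to φ. Since it is at least 1 on all of ℝ, the arc length L
  -- is a bijection of ℝ with a global differentiable inverse, and θ = φ + π/2 - arctan p.
  set h : ℝ → ℝ := fun φ => ρ φ * √(1 + p φ ^ 2) with hh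
  have hc : Continuous h := by fun_prop
  have hsq : ∀ φ, 1 ≤ √(1 + p φ ^ 2) := fun φ => by
    rw [Real.one_le_sqrt]
    nlinarith [sq_nonneg (p φ)]
  have h1 : ∀ φ, 1 ≤ h φ := fun φ => by
    have := hρ1 φ
    have := hsq φ
    simp only [hh]
    nlinarith
  set L : ℝ → ℝ := fun φ => ∫ s in (0 : ℝ)..φ, h s with hL
  have hLd : ∀ φ, HasDerivAt L (h φ) φ := fun φ => (hc.integral_hasStrictDerivAt 0 φ).hasDerivAt
  have hL0 : L 0 = 0 := by simp [hL]
  have hLc : Continuous L := continuous_iff_continuousAt.2 fun φ => (hLd φ).continuousAt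
  have hLm : StrictMono L := strictMono_of_hasDerivAt_pos hLd fun φ => by linarith [h1 φ]
  have hLi : ∀ a b, a ≤ b → b - a ≤ L b - L a := by
    intro a b hab
    have hm : Monotone fun φ => L φ - φ := monotone_of_hasDerivAt_nonneg
      (fun φ => (hLd φ).sub (hasDerivAt_id φ)) fun φ => by simpa using h1 φ
    have := hm hab
    simp only at this
    linarith
  have hLs : Function.Surjective L := by
    apply hLc.surjective
    · refine Filter.tendsto_atTop_mono' _ ?_ Filter.tendsto_id
      filter_upwards [Filter.eventually_ge_atTop 0] with x hx
      have := hLi 0 x hx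
      simp only [id]
      linarith
    · refine Filter.tendsto_atBot_mono' _ ?_ Filter.tendsto_id
      filter_upwards [Filter.eventually_le_atBot 0] with x hx
      have := hLi x 0 hx
      simp only [id]
      linarith
  let e := hLm.orderIsoOfSurjective L hLs
  have heL : ∀ t, L (e.symm t) = t := fun t => e.apply_symm_apply t
  have hLe : ∀ φ, e.symm (L φ) = φ := fun φ => e.symm_apply_apply φ
  have hec : Continuous e.symm := e.symm.continuous
  have hed : ∀ t, HasDerivAt e.symm (h (e.symm t))⁻¹ t := fun t =>
    HasDerivAt.of_local_left_inverse hec.continuousAt (hLd _) (by linarith [h1 (e.symm t)])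
      (Filter.Eventually.of_forall heL)
  have he0 : e.symm 0 = 0 := by
    have := hLe 0
    rwa [hL0] at this
  have hIoo : ∀ t ∈ Set.Ioo 0 (L (Real.pi / 2)), e.symm t ∈ Set.Ioo 0 (Real.pi / 2) := by
    intro t ht
    rw [← heL t] at ht
    exact ⟨hLm.lt_iff_lt.1 (hL0.symm ▸ ht.1), hLm.lt_iff_lt.1 ht.2⟩
  have hIoc : ∀ t ∈ Set.Ioc 0 (L (Real.pi / 2)), e.symm t ∈ Set.Ioc 0 (Real.pi / 2) := by
    intro t ht
    rw [← heL t] at ht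
    exact ⟨hLm.lt_iff_lt.1 (hL0.symm ▸ ht.1), hLm.le_iff_le.1 ht.2⟩
  have hIco : ∀ t ∈ Set.Ico 0 (L (Real.pi / 2)), e.symm t ∈ Set.Ico 0 (Real.pi / 2) := by
    intro t ht
    rw [← heL t] at ht
    exact ⟨hLm.le_iff_le.1 (hL0.symm ▸ ht.1), hLm.lt_iff_lt.1 ht.2⟩
  have hcos : ∀ φ, Real.cos (φ + Real.pi / 2 - Real.arctan (p φ)) =
      (p φ * Real.cos φ - Real.sin φ) / √(1 + p φ ^ 2) := fun φ => by
    rw [add_sub_right_comm, Real.cos_add_pi_div_two, Real.sin_sub, Real.cos_arctan,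
      Real.sin_arctan]
    ring
  have hsin : ∀ φ, Real.sin (φ + Real.pi / 2 - Real.arctan (p φ)) =
      (p φ * Real.sin φ + Real.cos φ) / √(1 + p φ ^ 2) := fun φ => by
    rw [add_sub_right_comm, Real.sin_add_pi_div_two, Real.cos_sub, Real.cos_arctan,
      Real.sin_arctan]
    ring
  refine ⟨L (Real.pi / 2), fun t => ρ (e.symm t) * Real.cos (e.symm t),
    fun t => ρ (e.symm t) * Real.sin (e.symm t),
    fun t => e.symm t + Real.pi / 2 - Real.arctan (p (e.symm t)), ?_, ?_, ?_, ?_, ?_⟩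
  · rw [← hL0]
    exact hLm (by positivity)
  · refine ⟨?_, ?_, ?_, ?_, ?_, ?_, ?_, ?_, ?_, ?_⟩
    · simp [he0, hρ0]
    · simp [he0]
    · simp [he0, hp0]
    · exact Continuous.continuousOn (by fun_prop)
    · exact Continuous.continuousOn (by fun_prop)
    · exact Continuous.continuousOn (by fun_prop)
    · intro t ht
      have h2 := hIoc t ht
      exact mul_pos (by linarith [hρ1 (e.symm t)])
        (Real.sin_pos_of_pos_of_lt_pi h2.1 (by linarith [h2.2, Real.pi_pos]))
    · intro t ht
      have h2 := ((hρ' _ (hIoo t ht)).mul (Real.hasDerivAt_cos _)).comp t (hed t)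
      refine h2.congr_deriv ?_
      rw [hcos]
      have := hρ1 (e.symm t)
      have := hsq (e.symm t)
      simp only [hh]
      field_simp
      ring
    · intro t ht
      have h2 := ((hρ' _ (hIoo t ht)).mul (Real.hasDerivAt_sin _)).comp t (hed t)
      refine h2.congr_deriv ?_
      rw [hsin]
      have := hρ1 (e.symm t)
      have := hsq (e.symm t)
      simp only [hh]
      field_simp
    · intro t ht
      have h3 := hIoo t ht
      have h2 := (((hasDerivAt_id _).add_const (Real.pi / 2)).sub
        (hp' _ h3).arctan).comp t (hed t)
      refine h2.congr_deriv ?_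
      rw [hsin, hcos]
      have h4 := hρ1 (e.symm t)
      have h5 := hsq (e.symm t)
      have h6 := Real.sin_pos_of_pos_of_lt_pi h3.1 (by linarith [h3.2, Real.pi_pos])
      have h7 := Real.sin_sq_add_cos_sq (e.symm t)
      have h8 : 0 < 1 + p (e.symm t) ^ 2 := by positivity
      simp only [hh]
      generalize e.symm t = φ at *
      field_simp
      have h9 : Real.cos φ ^ 2 = 1 - Real.sin φ ^ 2 := by linarith
      ring_nf
      simp only [h9]
      ring
  · intro t ht
    have h2 := hIco t ht
    exact mul_pos (by linarith [hρ1 (e.symm t)])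
      (Real.cos_pos_of_mem_Ioo ⟨by linarith [h2.1, Real.pi_pos], h2.2⟩)
  · simp [hLe]
  · simp only [hLe]
    ring

theorem hasDerivAt_of_eq_add_integral {f g : ℝ → ℝ} {b : ℝ} (hg : Continuous g)
    (h : ∀ x ∈ Set.Icc (0 : ℝ) 1, f x = b + ∫ s in (0 : ℝ)..x, g s) {x : ℝ}
    (hx : x ∈ Set.Ioo (0 : ℝ) 1) : HasDerivAt f (g x) x := by
  have h1 : HasDerivAt (fun x => b + ∫ s in (0 : ℝ)..x, g s) (g x) x :=
    (hg.integral_hasStrictDerivAt 0 x).hasDerivAt.const_add b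
  refine h1.congr_of_eventuallyEq ?_
  filter_upwards [isOpen_Ioo.mem_nhds hx] with y hy
  exact h y (Set.Ioo_subset_Icc_self hy)

/-- Undoes the substitution: ρ = √(2R) and p = y sin φ at x = 1 - cos φ, where x(2 - x) = sin² φ.
The value x = 1 corresponds to φ = π/2. -/
theorem hitsRAxisAtAngle_of_profileMap {c : ℝ} (hc : 0 < c) {u : C(I, ℝ) × C(I, ℝ)}
    (hu : profileMap radialMean unitWeight unitCoord u = (0, (c ^ 2 / 2) • 1))
    (hpos : ∀ x, 1 / 2 ≤ u.2 x) :
    HitsRAxisAtAngle c (Real.pi - Real.arctan (u.1 1)) := by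
  obtain ⟨y, R⟩ := u
  simp only [profileMap, Prod.mk.injEq] at hu hpos ⊢
  obtain ⟨hu1, hu2⟩ := hu
  set G : C(I, ℝ) := (2 : ℝ) • ((1 + unitCoord * (2 - unitCoord) * y ^ 2) * (1 - R)) -
      (1 - unitCoord) * (unitCoord * (2 - unitCoord)) * y ^ 3 with hG
  set ye : ℝ → ℝ := Set.IccExtend zero_le_one y with hye
  set Re : ℝ → ℝ := Set.IccExtend zero_le_one R with hRe
  have hyc : Continuous ye := y.continuous.Icc_extend'
  have hRc : Continuous Re := R.continuous.Icc_extend'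
  have hy : ∀ x : I, ye x = y x := fun x => Set.IccExtend_val _ _ x
  have hR : ∀ x : I, Re x = R x := fun x => Set.IccExtend_val _ _ x
  have hRpos : ∀ x, 1 / 2 ≤ Re x := fun x => hpos _
  have hRi : ∀ x ∈ Set.Icc (0 : ℝ) 1, Re x = c ^ 2 / 2 + ∫ s in (0 : ℝ)..x, 2 * (ye s * Re s) := by
    intro x hx
    have h1 := DFunLike.congr_fun hu2 ⟨x, hx⟩
    have h2 := mul_radialMean ((2 : ℝ) • (y * R)) ⟨x, hx⟩
    simp only [ContinuousMap.sub_apply, ContinuousMap.mul_apply, unitCoord_apply] at h1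
    rw [h2, ← hR] at h1
    have h3 : ((c ^ 2 / 2) • (1 : C(I, ℝ))) ⟨x, hx⟩ = c ^ 2 / 2 := by simp
    rw [h3] at h1
    exact eq_add_of_sub_eq h1
  have hyi : ∀ x ∈ Set.Icc (0 : ℝ) 1,
      x * (2 - x) * ye x = 0 + ∫ s in (0 : ℝ)..x, Set.IccExtend zero_le_one G s := by
    intro x hx
    have h1 := DFunLike.congr_fun hu1 ⟨x, hx⟩
    have h2 := mul_radialMean G ⟨x, hx⟩
    simp only [ContinuousMap.sub_apply, ContinuousMap.mul_apply, unitWeight_apply,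
      ContinuousMap.zero_apply] at h1
    rw [← hy] at h1
    simp only at h1 h2
    have h3 : 2 - x ≠ 0 := by linarith [hx.2]
    rw [zero_add, ← h2, sub_eq_zero.1 h1]
    field_simp
  have hRd : ∀ x ∈ Set.Ioo (0 : ℝ) 1, HasDerivAt Re (2 * (ye x * Re x)) x := fun x hx =>
    hasDerivAt_of_eq_add_integral (by fun_prop) hRi hx
  have hyd : ∀ x ∈ Set.Ioo (0 : ℝ) 1, HasDerivAt (fun x => x * (2 - x) * ye x)
      (2 * ((1 + x * (2 - x) * ye x ^ 2) * (1 - Re x)) -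
        (1 - x) * (x * (2 - x)) * ye x ^ 3) x := by
    intro x hx
    refine (hasDerivAt_of_eq_add_integral G.continuous.Icc_extend' hyi hx).congr_deriv ?_
    have hx' := Set.Ioo_subset_Icc_self hx
    rw [hye, hRe]
    simp only [Set.IccExtend_of_mem _ _ hx', hG]
    simp
    rfl
  have hmem : ∀ φ ∈ Set.Ioo 0 (Real.pi / 2), 1 - Real.cos φ ∈ Set.Ioo (0 : ℝ) 1 := by
    intro φ hφ
    have h1 := Real.cos_pos_of_mem_Ioo ⟨by linarith [hφ.1, Real.pi_pos], hφ.2⟩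
    have h2 := Real.cos_lt_cos_of_nonneg_of_le_pi_div_two le_rfl hφ.2.le hφ.1
    rw [Real.cos_zero] at h2
    exact ⟨by linarith, by linarith⟩
  have hcosd : ∀ φ, HasDerivAt (fun φ => 1 - Real.cos φ) (Real.sin φ) φ := fun φ => by
    simpa using (Real.hasDerivAt_cos φ).const_sub 1
  have hsq : ∀ φ, (1 - Real.cos φ) * (2 - (1 - Real.cos φ)) = Real.sin φ ^ 2 := fun φ => by
    have := Real.sin_sq_add_cos_sq φ
    linear_combination -this
  have key := hitsRAxisAtAngle_of_polar (c := c)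
    (ρ := fun φ => √(2 * Re (1 - Real.cos φ)))
    (p := fun φ => Real.sin φ * ye (1 - Real.cos φ)) (by fun_prop) (by fun_prop) ?_ ?_ ?_ ?_ ?_
  · have h1 : ye 1 = y 1 := hy 1
    simpa [h1] using key
  · intro φ
    rw [Real.one_le_sqrt]
    linarith [hRpos (1 - Real.cos φ)]
  · have h1 := hRi 0 (by simp)
    simp only [intervalIntegral.integral_same, add_zero] at h1
    simp only [Real.cos_zero, sub_self, h1]
    rw [mul_div_cancel₀ _ two_ne_zero, Real.sqrt_sq hc.le]
  · simp
  · intro φ hφ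
    have h1 := hRpos (1 - Real.cos φ)
    have h2 := (((hRd _ (hmem φ hφ)).comp φ (hcosd φ)).const_mul 2).sqrt
      (by simp only [Function.comp]; linarith)
    refine h2.congr_deriv ?_
    simp only [Function.comp]
    have h3 : 0 < √(2 * Re (1 - Real.cos φ)) := Real.sqrt_pos.2 (by linarith)
    have h4 := Real.sq_sqrt (show 0 ≤ 2 * Re (1 - Real.cos φ) by linarith)
    field_simp
    rw [h4]
    ring
  · intro φ hφ
    have hs : 0 < Real.sin φ :=
      Real.sin_pos_of_pos_of_lt_pi hφ.1 (by linarith [hφ.2, Real.pi_pos])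
    -- The integrated equation controls x(2 - x) y = p sin φ; division by sin φ recovers p.
    have h2 := ((hyd _ (hmem φ hφ)).comp φ (hcosd φ)).div (Real.hasDerivAt_sin φ) hs.ne'
    have h3 := h2.congr_of_eventuallyEq
        (f₁ := fun φ => Real.sin φ * ye (1 - Real.cos φ)) (by
      filter_upwards [(Real.continuous_sin.continuousAt (x := φ)).eventually_ne hs.ne'] with ψ hψ
      simp only [Function.comp, Pi.div_apply]
      rw [hsq]
      field_simp)
    refine h3.congr_deriv ?_
    simp only [Function.comp, hsq]
    have h4 := Real.sq_sqrt (show 0 ≤ 2 * Re (1 - Real.cos φ) by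
      linarith [hRpos (1 - Real.cos φ)])
    rw [h4]
    field_simp
    ring

/-! ### Uniqueness of orbits -/

theorem abs_sub_le_of_abs_hasDerivAt_le {f f' : ℝ → ℝ} {a b K : ℝ} (hab : a ≤ b)
    (hf : ContinuousOn f (Set.Icc a b)) (hf' : ∀ x ∈ Set.Ioo a b, HasDerivAt f (f' x) x)
    (hK : ∀ x ∈ Set.Ioo a b, |f' x| ≤ K) : |f b - f a| ≤ K * (b - a) := by
  rcases hab.eq_or_lt with rfl | hab
  · simp
  obtain ⟨x, hx, h⟩ := exists_hasDerivAt_eq_slope f f' hab hf hf'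
  have h1 := hK x hx
  have h2 : 0 < b - a := sub_pos.2 hab
  rwa [h, abs_div, abs_of_pos h2, div_le_iff₀ h2] at h1

/-- Within distance 1 of π/2 the sine is at least 1 - 1/2, so the cosine can be inverted with
constant 2. -/
theorem half_abs_sub_le_abs_cos_sub {x y : ℝ} (hx : |x - Real.pi / 2| ≤ 1)
    (hy : |y - Real.pi / 2| ≤ 1) : 1 / 2 * |x - y| ≤ |Real.cos x - Real.cos y| := by
  wlog hxy : x < y generalizing x y
  · rcases (not_lt.1 hxy).eq_or_lt with rfl | h
    · simp
    · rw [abs_sub_comm x, abs_sub_comm (Real.cos x)]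
      exact this hy hx h
  obtain ⟨ξ, hξ, h⟩ := exists_hasDerivAt_eq_slope Real.cos (fun x => -Real.sin x) hxy
    Real.continuous_cos.continuousOn fun x _ => Real.hasDerivAt_cos x
  have h1 : 0 < y - x := sub_pos.2 hxy
  have h2 : 1 / 2 ≤ Real.sin ξ := by
    rw [← Real.cos_sub_pi_div_two]
    have h3 := Real.one_sub_sq_div_two_le_cos (x := ξ - Real.pi / 2)
    have h4 : |ξ - Real.pi / 2| ≤ 1 := by
      rw [abs_le] at *
      constructor <;> linarith [hξ.1, hξ.2]
    have h5 : (ξ - Real.pi / 2) ^ 2 ≤ 1 := by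
      rw [← sq_abs]
      exact pow_le_one₀ (abs_nonneg _) h4
    linarith
  rw [eq_div_iff h1.ne'] at h
  rw [abs_sub_comm x, abs_sub_comm (Real.cos x), ← h, abs_mul, abs_neg, abs_of_pos h1]
  exact mul_le_mul_of_nonneg_right (h2.trans (le_abs_self _)) h1.le

namespace IsCapOrbit

variable {c T : ℝ} {z r θ : ℝ → ℝ}

theorem mono (h : IsCapOrbit c T z r θ) {T' : ℝ} (hT : T' ≤ T) : IsCapOrbit c T' z r θ where
  z_zero := h.z_zero
  r_zero := h.r_zero
  theta_zero := h.theta_zero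
  continuousOn_z := h.continuousOn_z.mono (Set.Icc_subset_Icc_right hT)
  continuousOn_r := h.continuousOn_r.mono (Set.Icc_subset_Icc_right hT)
  continuousOn_theta := h.continuousOn_theta.mono (Set.Icc_subset_Icc_right hT)
  r_pos := fun t ht => h.r_pos t (Set.Ioc_subset_Ioc_right hT ht)
  deriv_z := fun t ht => h.deriv_z t (Set.Ioo_subset_Ioo_right hT ht)
  deriv_r := fun t ht => h.deriv_r t (Set.Ioo_subset_Ioo_right hT ht)
  deriv_theta := fun t ht => h.deriv_theta t (Set.Ioo_subset_Ioo_right hT ht)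

/-- The a priori bounds satisfied by an orbit for a short time `ε`. -/
theorem exists_short_time_bounds (h : IsCapOrbit c T z r θ) (hT : 0 < T) :
    ∃ ε, 0 < ε ∧ ε ≤ T ∧ ε ≤ 1 ∧ ∀ t ∈ Set.Icc 0 ε,
      |z t| ≤ |c| + 1 ∧ |θ t - Real.pi / 2| ≤ 1 ∧ t / 2 ≤ r t ∧ r t ≤ t := by
  have h0 : (0 : ℝ) ∈ Set.Icc 0 T := ⟨le_rfl, hT.le⟩
  have hz : ∀ᶠ t in 𝓝[Set.Icc 0 T] 0, |z t| < |c| + 1 :=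
    (h.continuousOn_z 0 h0).abs.eventually_lt_const (by simp only [h.z_zero]; linarith)
  have hθ : ∀ᶠ t in 𝓝[Set.Icc 0 T] 0, |θ t - Real.pi / 2| < 1 :=
    ((h.continuousOn_theta 0 h0).sub continuousWithinAt_const).abs.eventually_lt_const
      (by simp [h.theta_zero])
  have hI : 𝓝[Set.Icc 0 T] (0 : ℝ) = 𝓝[≥] 0 := nhdsWithin_Icc_eq_nhdsGE hT
  have h1 := hz.and hθ
  rw [hI] at h1
  obtain ⟨δ, hδ, h2⟩ := (mem_nhdsGE_iff_exists_Icc_subset).1 h1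
  have hδ' : 0 < δ := hδ
  refine ⟨min δ (min T 1), by positivity, (min_le_right _ _).trans (min_le_left _ _),
    (min_le_right _ _).trans (min_le_right _ _), fun t ht => ?_⟩
  have htδ : t ≤ δ := ht.2.trans (min_le_left _ _)
  have htT : t ≤ T := ht.2.trans ((min_le_right _ _).trans (min_le_left _ _))
  have h3 := h2 ⟨ht.1, htδ⟩
  refine ⟨h3.1.le, h3.2.le, ?_⟩
  rcases ht.1.eq_or_lt with rfl | ht0
  · simp [h.r_zero]
  obtain ⟨s, hs, h4⟩ := exists_hasDerivAt_eq_slope r (fun s => Real.sin (θ s)) ht0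
    (h.continuousOn_r.mono (Set.Icc_subset_Icc_right htT))
    fun s hs => h.deriv_r s (Set.Ioo_subset_Ioo_right htT hs)
  rw [h.r_zero, sub_zero, sub_zero, eq_div_iff ht0.ne'] at h4
  have h5 : 1 / 2 ≤ Real.sin (θ s) := by
    rw [← Real.cos_sub_pi_div_two]
    have h3 := Real.one_sub_sq_div_two_le_cos (x := θ s - Real.pi / 2)
    have h5 : (θ s - Real.pi / 2) ^ 2 ≤ 1 := by
      rw [← sq_abs]
      exact pow_le_one₀ (abs_nonneg _) (h2 ⟨hs.1.le, hs.2.le.trans htδ⟩).2.le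
    linarith
  have h6 := Real.sin_le_one (θ s)
  constructor <;> nlinarith

/-- The momentum `r cos θ` satisfies an equation without singular terms. -/
theorem hasDerivAt_mul_cos (h : IsCapOrbit c T z r θ) {t : ℝ} (ht : t ∈ Set.Ioo 0 T) :
    HasDerivAt (fun t => r t * Real.cos (θ t))
      (-(r t * (Real.sin (θ t) * (z t * Real.sin (θ t) - r t * Real.cos (θ t))))) t := by
  have hr := (h.r_pos t ⟨ht.1, ht.2.le⟩).ne'
  refine ((h.deriv_r t ht).mul (h.deriv_theta t ht).cos).congr_deriv ?_
  field_simp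
  ring

/-- On [ε, T] both orbits stay in a compact convex set on which r is bounded away from 0; there the
field is C¹, hence Lipschitz. -/
theorem eqOn_of_eq (h : IsCapOrbit c T z r θ) {c' : ℝ} {z' r' θ' : ℝ → ℝ}
    (h' : IsCapOrbit c' T z' r' θ') {ε : ℝ} (hε : 0 < ε) (hεT : ε ≤ T)
    (hz : z ε = z' ε) (hr : r ε = r' ε) (hθ : θ ε = θ' ε) :
    ∀ t ∈ Set.Icc ε T, z t = z' t ∧ r t = r' t ∧ θ t = θ' t := by
  have hsub : Set.Icc ε T ⊆ Set.Icc 0 T := Set.Icc_subset_Icc_left hε.le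
  have key : ∀ {c : ℝ} {z r θ : ℝ → ℝ}, IsCapOrbit c T z r θ →
      ContinuousOn (fun t => (z t, r t, θ t)) (Set.Icc ε T) ∧
      (∀ t ∈ Set.Ico ε T, HasDerivWithinAt (fun t => (z t, r t, θ t))
        (Real.cos (θ t), Real.sin (θ t),
          z t * Real.sin (θ t) + (1 / r t - r t) * Real.cos (θ t)) (Set.Ici t) t) ∧
      ∃ M, 0 < M ∧ ∀ t ∈ Set.Icc ε T, |z t| ≤ M ∧ M⁻¹ ≤ r t ∧ r t ≤ M ∧ |θ t| ≤ M := by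
    intro c z r θ h
    have hz := h.continuousOn_z.mono hsub
    have hr := h.continuousOn_r.mono hsub
    have hθ := h.continuousOn_theta.mono hsub
    have hr0 : ∀ t ∈ Set.Icc ε T, 0 < r t := fun t ht => h.r_pos t ⟨hε.trans_le ht.1, ht.2⟩
    refine ⟨hz.prodMk (hr.prodMk hθ), fun t ht => ?_, ?_⟩
    · have ht' : t ∈ Set.Ioo 0 T := ⟨hε.trans_le ht.1, ht.2⟩
      exact ((h.deriv_z t ht').prodMk ((h.deriv_r t ht').prodMk
        (h.deriv_theta t ht'))).hasDerivWithinAt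
    · have hcont : ContinuousOn (fun t => |z t| + |r t| + |(r t)⁻¹| + |θ t|) (Set.Icc ε T) :=
        ((hz.abs.add hr.abs).add (hr.inv₀ fun t ht => (hr0 t ht).ne').abs).add hθ.abs
      obtain ⟨M, hM⟩ := isCompact_Icc.bddAbove_image hcont
      have hM' : ∀ t ∈ Set.Icc ε T, |z t| + |r t| + |(r t)⁻¹| + |θ t| ≤ M := fun t ht =>
        hM (Set.mem_image_of_mem _ ht)
      have hpos : 0 < M := by
        have h1 := hM' ε ⟨le_rfl, hεT⟩
        have h2 := abs_pos.2 (hr0 ε ⟨le_rfl, hεT⟩).ne'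
        linarith [abs_nonneg (z ε), abs_nonneg (r ε)⁻¹, abs_nonneg (θ ε)]
      refine ⟨M, hpos, fun t ht => ?_⟩
      have h1 := hM' t ht
      have h2 := hr0 t ht
      have h3 := abs_nonneg (z t)
      have h4 := abs_nonneg (θ t)
      rw [abs_of_pos h2, abs_of_pos (inv_pos.2 h2)] at h1
      have h5 := inv_pos.2 h2
      refine ⟨by linarith, ?_, by linarith, by linarith⟩
      rw [inv_le_comm₀ hpos h2]
      linarith
  obtain ⟨hc, hd, M, hM0, hM⟩ := key h
  obtain ⟨hc', hd', M', hM0', hM'⟩ := key h'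
  set N := max M M'
  have hN : 0 < N := lt_max_of_lt_left hM0
  set s : Set (ℝ × ℝ × ℝ) := Set.Icc (-N) N ×ˢ Set.Icc N⁻¹ N ×ˢ Set.Icc (-N) N with hs
  have hsc : IsCompact s := isCompact_Icc.prod (isCompact_Icc.prod isCompact_Icc)
  have hsx : Convex ℝ s := (convex_Icc _ _).prod ((convex_Icc _ _).prod (convex_Icc _ _))
  have hv : ContDiffOn ℝ 1 (fun u : ℝ × ℝ × ℝ => (Real.cos u.2.2, Real.sin u.2.2,
      u.1 * Real.sin u.2.2 + (1 / u.2.1 - u.2.1) * Real.cos u.2.2)) s := by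
    have : ∀ u ∈ s, u.2.1 ≠ 0 := fun u hu => ((inv_pos.2 hN).trans_le hu.2.1.1).ne'
    fun_prop (disch := assumption)
  obtain ⟨K, hK⟩ := hv.exists_lipschitzOnWith one_ne_zero hsx hsc
  have hmem : ∀ {L : ℝ} {z r θ : ℝ → ℝ}, 0 < L → L ≤ N →
      (∀ t ∈ Set.Icc ε T, |z t| ≤ L ∧ L⁻¹ ≤ r t ∧ r t ≤ L ∧ |θ t| ≤ L) →
      ∀ t ∈ Set.Ico ε T, (z t, r t, θ t) ∈ s := by
    intro L z r θ hL0 hLN hL t ht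
    obtain ⟨h1, h2, h3, h4⟩ := hL t ⟨ht.1, ht.2.le⟩
    exact ⟨abs_le.1 (h1.trans hLN), ⟨(inv_anti₀ hL0 hLN).trans h2, h3.trans hLN⟩,
      abs_le.1 (h4.trans hLN)⟩
  have := ODE_solution_unique_of_mem_Icc_right (s := fun _ => s) (fun _ _ => hK) hc hd
    (hmem hM0 (le_max_left _ _) hM) hc' hd' (hmem hM0' (le_max_right _ _) hM')
    (by simp only [hz, hr, hθ])
  intro t ht
  simpa using this ht

end IsCapOrbit

/-- The factor s is the point: integrated up to t it bounds the difference of momenta by a multiple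
of D t², which survives the division by r ≥ t/2. -/
theorem abs_momentum_field_sub_le {M D s z z' r r' a a' b b' : ℝ} (hs : s ≤ 1)
    (hD : 0 ≤ D) (hz : |z| ≤ M) (hz' : |z'| ≤ M) (hr0 : 0 ≤ r) (hr0' : 0 ≤ r')
    (hr : r ≤ s) (hr' : r' ≤ s) (ha : |a| ≤ 1) (ha' : |a'| ≤ 1) (hb : |b| ≤ 1)
    (hdz : |z - z'| ≤ D * s) (hdr : |r - r'| ≤ D * s) (hda : |a - a'| ≤ D)
    (hdb : |b - b'| ≤ D) :
    |r * (a * (z * a - r * b)) - r' * (a' * (z' * a' - r' * b'))| ≤ s * D * (3 * M + 5) := by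
  have hs0 : 0 ≤ s := hr0.trans hr
  have mul_le : ∀ {x y X Y : ℝ}, |x| ≤ X → |y| ≤ Y → |x * y| ≤ X * Y := fun hx hy => by
    rw [abs_mul]
    exact mul_le_mul hx hy (abs_nonneg _) ((abs_nonneg _).trans hx)
  have hr1 : |r| ≤ s := by rwa [abs_of_nonneg hr0]
  have hr1' : |r'| ≤ s := by rwa [abs_of_nonneg hr0']
  have hDs : D * s ≤ D := mul_le_of_le_one_right hD hs
  have hg : |z * a - r * b| ≤ M + 1 := by
    have := abs_sub (z * a) (r * b)
    linarith [mul_le hz ha, mul_le hr1 hb]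
  have hdg : |(z * a - r * b) - (z' * a' - r' * b')| ≤ (M + 3) * D := by
    have e : (z * a - r * b) - (z' * a' - r' * b') =
        ((z - z') * a + z' * (a - a')) - ((r - r') * b + r' * (b - b')) := by ring
    rw [e]
    have h1 := abs_sub ((z - z') * a + z' * (a - a')) ((r - r') * b + r' * (b - b'))
    have h2 := abs_add_le ((z - z') * a) (z' * (a - a'))
    have h3 := abs_add_le ((r - r') * b) (r' * (b - b'))
    linarith [mul_le hdz ha, mul_le hz' hda, mul_le hdr hb, mul_le hr1' hdb]
  have e : r * (a * (z * a - r * b)) - r' * (a' * (z' * a' - r' * b')) =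
      (r - r') * (a * (z * a - r * b)) + r' * ((a - a') * (z * a - r * b)) +
        r' * (a' * ((z * a - r * b) - (z' * a' - r' * b'))) := by ring
  rw [e]
  have h1 := abs_add_three ((r - r') * (a * (z * a - r * b)))
    (r' * ((a - a') * (z * a - r * b))) (r' * (a' * ((z * a - r * b) - (z' * a' - r' * b'))))
  linarith [mul_le hdr (mul_le ha hg), mul_le hr1' (mul_le hda hg),
    mul_le hr1' (mul_le ha' hdg)]

namespace IsCapOrbit

variable {c T : ℝ} {z r θ : ℝ → ℝ}

/-- With D the maximum of |θ - θ'|, the positions differ by at most D t. Comparing momenta at a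
point t₀ of maximum yields D/2 ≤ 2(5M + 7) t₀ D, so D = 0 for short times. -/
theorem eqOn_short_time (h : IsCapOrbit c T z r θ) {z' r' θ' : ℝ → ℝ}
    (h' : IsCapOrbit c T z' r' θ') (hT : 0 < T) :
    ∃ ε, 0 < ε ∧ ε ≤ T ∧ ∀ t ∈ Set.Icc 0 ε, z t = z' t ∧ r t = r' t ∧ θ t = θ' t := by
  obtain ⟨ε₁, hε₁, hεT, hε1, hb⟩ := h.exists_short_time_bounds hT
  obtain ⟨ε₂, hε₂, -, -, hb'⟩ := h'.exists_short_time_bounds hT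
  set M := |c| + 1 with hM
  have hM0 : 0 ≤ M := by positivity
  -- 5M + 7 is the sum of 3M + 5, from the momentum difference, and 2(M + 1), from the bound on cos
  -- θ'; the factor 8 makes the final estimate D/2 ≤ D/4.
  set τ := min (min ε₁ ε₂) (1 / (8 * (5 * M + 7))) with hτ
  have hτ0 : 0 < τ := by positivity
  have hτ₁ : τ ≤ ε₁ := (min_le_left _ _).trans (min_le_left _ _)
  have hτ₂ : τ ≤ ε₂ := (min_le_left _ _).trans (min_le_right _ _)
  have hτT : τ ≤ T := hτ₁.trans hεT
  have hτ1 : τ ≤ 1 := hτ₁.trans hε1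
  have hτM : 8 * (5 * M + 7) * τ ≤ 1 := by
    have h1 : τ ≤ 1 / (8 * (5 * M + 7)) := min_le_right _ _
    rw [le_div_iff₀ (by positivity)] at h1
    linarith
  replace hb : ∀ t ∈ Set.Icc 0 τ, |z t| ≤ M ∧ |θ t - Real.pi / 2| ≤ 1 ∧ t / 2 ≤ r t ∧ r t ≤ t :=
    fun t ht => hb t ⟨ht.1, ht.2.trans hτ₁⟩
  replace hb' : ∀ t ∈ Set.Icc 0 τ,
      |z' t| ≤ M ∧ |θ' t - Real.pi / 2| ≤ 1 ∧ t / 2 ≤ r' t ∧ r' t ≤ t :=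
    fun t ht => hb' t ⟨ht.1, ht.2.trans hτ₂⟩
  replace h := h.mono hτT
  replace h' := h'.mono hτT
  clear_value τ M
  have hsub : ∀ {t}, t ∈ Set.Icc 0 τ → Set.Icc 0 t ⊆ Set.Icc 0 τ := fun ht =>
    Set.Icc_subset_Icc_right ht.2
  have hsubo : ∀ {t}, t ∈ Set.Icc 0 τ → Set.Ioo 0 t ⊆ Set.Ioo 0 τ := fun ht =>
    Set.Ioo_subset_Ioo_right ht.2
  obtain ⟨t₀, ht₀, hmax⟩ := isCompact_Icc.exists_isMaxOn (Set.nonempty_Icc.2 hτ0.le)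
    (h.continuousOn_theta.sub h'.continuousOn_theta).abs
  set D := |θ t₀ - θ' t₀| with hD
  have hD0 : 0 ≤ D := abs_nonneg _
  have hDθ : ∀ t ∈ Set.Icc 0 τ, |θ t - θ' t| ≤ D := fun t ht => hmax ht
  have hDsin : ∀ t ∈ Set.Icc 0 τ, |Real.sin (θ t) - Real.sin (θ' t)| ≤ D := fun t ht =>
    (Real.abs_sin_sub_sin_le _ _).trans (hDθ t ht)
  have hDcos : ∀ t ∈ Set.Icc 0 τ, |Real.cos (θ t) - Real.cos (θ' t)| ≤ D := fun t ht =>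
    (Real.abs_cos_sub_cos_le _ _).trans (hDθ t ht)
  have hDr : ∀ t ∈ Set.Icc 0 τ, |r t - r' t| ≤ D * t := by
    intro t ht
    have := abs_sub_le_of_abs_hasDerivAt_le ht.1
      ((h.continuousOn_r.sub h'.continuousOn_r).mono (hsub ht))
      (fun s hs => (h.deriv_r s (hsubo ht hs)).sub (h'.deriv_r s (hsubo ht hs)))
      (fun s hs => hDsin s (Set.Ioo_subset_Icc_self (hsubo ht hs)))
    simpa [h.r_zero, h'.r_zero] using this
  have hDz : ∀ t ∈ Set.Icc 0 τ, |z t - z' t| ≤ D * t := by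
    intro t ht
    have := abs_sub_le_of_abs_hasDerivAt_le ht.1
      ((h.continuousOn_z.sub h'.continuousOn_z).mono (hsub ht))
      (fun s hs => (h.deriv_z s (hsubo ht hs)).sub (h'.deriv_z s (hsubo ht hs)))
      (fun s hs => hDcos s (Set.Ioo_subset_Icc_self (hsubo ht hs)))
    simpa [h.z_zero, h'.z_zero] using this
  suffices hDz0 : D = 0 by
    refine ⟨τ, hτ0, hτT, fun t ht => ?_⟩
    have h1 := hDz t ht
    have h2 := hDr t ht
    have h3 := hDθ t ht
    rw [hDz0] at h1 h2 h3
    rw [zero_mul, abs_nonpos_iff, sub_eq_zero] at h1 h2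
    rw [abs_nonpos_iff, sub_eq_zero] at h3
    exact ⟨h1, h2, h3⟩
  rcases ht₀.1.eq_or_lt with h0 | ht0
  · rw [hD, ← h0, h.theta_zero, h'.theta_zero, sub_self, abs_zero]
  have hc := h.continuousOn_r.mul (Real.continuous_cos.comp_continuousOn h.continuousOn_theta)
  have hc' := h'.continuousOn_r.mul (Real.continuous_cos.comp_continuousOn h'.continuousOn_theta)
  -- the momentum of the second orbit is quadratically small
  have hcos : |r' t₀ * Real.cos (θ' t₀)| ≤ t₀ * (M + 1) * t₀ := by
    have := abs_sub_le_of_abs_hasDerivAt_le (K := t₀ * (M + 1)) ht₀.1 (hc'.mono (hsub ht₀))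
      (fun s hs => h'.hasDerivAt_mul_cos (hsubo ht₀ hs)) (fun s hs => by
        have hs' := Set.Ioo_subset_Icc_self (hsubo ht₀ hs)
        obtain ⟨h1, -, h2, h3⟩ := hb' s hs'
        have hr0 : 0 ≤ r' s := by linarith [hs.1]
        have h4 := Real.abs_sin_le_one (θ' s)
        have h5 := Real.abs_cos_le_one (θ' s)
        have h6 : |z' s * Real.sin (θ' s) - r' s * Real.cos (θ' s)| ≤ M + 1 := by
          refine (abs_sub _ _).trans ?_
          rw [abs_mul, abs_mul, abs_of_nonneg hr0]
          have : |z' s| * |Real.sin (θ' s)| ≤ M * 1 := mul_le_mul h1 h4 (abs_nonneg _) hM0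
          have : r' s * |Real.cos (θ' s)| ≤ 1 * 1 :=
            mul_le_mul (by linarith [hs'.2]) h5 (abs_nonneg _) zero_le_one
          linarith
        rw [abs_neg, abs_mul, abs_mul, abs_of_nonneg hr0]
        calc _ ≤ t₀ * (1 * (M + 1)) := by
              refine mul_le_mul (by linarith [hs.2]) ?_ (by positivity) ht0.le
              exact mul_le_mul h4 h6 (abs_nonneg _) zero_le_one
          _ = _ := by ring)
    simpa [h'.r_zero] using this
  have hdiff : |r t₀ * Real.cos (θ t₀) - r' t₀ * Real.cos (θ' t₀)| ≤
      t₀ * D * (3 * M + 5) * t₀ := by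
    have := abs_sub_le_of_abs_hasDerivAt_le (K := t₀ * D * (3 * M + 5)) ht₀.1
      ((hc.sub hc').mono (hsub ht₀))
      (fun s hs => (h.hasDerivAt_mul_cos (hsubo ht₀ hs)).sub
        (h'.hasDerivAt_mul_cos (hsubo ht₀ hs))) (fun s hs => by
        have hs' := Set.Ioo_subset_Icc_self (hsubo ht₀ hs)
        obtain ⟨h1, -, h2, h3⟩ := hb s hs'
        obtain ⟨h1', -, h2', h3'⟩ := hb' s hs'
        have := abs_momentum_field_sub_le (by linarith [hs'.2]) hD0 h1 h1'
          (by linarith [hs.1]) (by linarith [hs.1]) h3 h3' (Real.abs_sin_le_one _)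
          (Real.abs_sin_le_one _) (Real.abs_cos_le_one _) (hDz s hs') (hDr s hs') (hDsin s hs')
          (hDcos s hs')
        rw [neg_sub_neg, abs_sub_comm]
        refine this.trans ?_
        gcongr
        exact hs.2.le)
    simpa [h.r_zero, h'.r_zero] using this
  obtain ⟨-, h1, h2, h3⟩ := hb t₀ ht₀
  obtain ⟨-, h1', h2', h3'⟩ := hb' t₀ ht₀
  have h4 := half_abs_sub_le_abs_cos_sub h1 h1'
  rw [← hD] at h4
  have h5 : |Real.cos (θ' t₀)| ≤ 2 * (M + 1) * t₀ := by
    rw [abs_mul, abs_of_nonneg (by linarith)] at hcos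
    have : t₀ / 2 * |Real.cos (θ' t₀)| ≤ t₀ / 2 * (2 * (M + 1) * t₀) :=
      (mul_le_mul_of_nonneg_right h2' (abs_nonneg _)).trans (hcos.trans (by linarith))
    exact le_of_mul_le_mul_left this (by linarith)
  have h6 : |r t₀ * (Real.cos (θ t₀) - Real.cos (θ' t₀))| ≤ t₀ / 2 * (2 * (5 * M + 7) * t₀ * D) := by
    have e : r t₀ * (Real.cos (θ t₀) - Real.cos (θ' t₀)) =
        (r t₀ * Real.cos (θ t₀) - r' t₀ * Real.cos (θ' t₀)) -
          (r t₀ - r' t₀) * Real.cos (θ' t₀) := by ring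
    rw [e]
    refine (abs_sub _ _).trans ?_
    have h7 : |(r t₀ - r' t₀) * Real.cos (θ' t₀)| ≤ D * t₀ * (2 * (M + 1) * t₀) := by
      rw [abs_mul]
      exact mul_le_mul (hDr t₀ ht₀) h5 (abs_nonneg _) (by positivity)
    linarith
  rw [abs_mul, abs_of_nonneg (by linarith)] at h6
  have h7 : |Real.cos (θ t₀) - Real.cos (θ' t₀)| ≤ 2 * (5 * M + 7) * t₀ * D :=
    le_of_mul_le_mul_left ((mul_le_mul_of_nonneg_right h2 (abs_nonneg _)).trans h6)
      (by linarith)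
  have h8 : 8 * (5 * M + 7) * t₀ * D ≤ 1 * D := by
    refine mul_le_mul_of_nonneg_right (le_trans ?_ hτM) hD0
    exact mul_le_mul_of_nonneg_left ht₀.2 (by positivity)
  linarith

/-- Two orbits issued from the same point of the axis agree. -/
theorem unique (h : IsCapOrbit c T z r θ) {T' : ℝ} {z' r' θ' : ℝ → ℝ}
    (h' : IsCapOrbit c T' z' r' θ') :
    ∀ t ∈ Set.Icc 0 (min T T'), z t = z' t ∧ r t = r' t ∧ θ t = θ' t := by
  intro t ht
  replace h := h.mono (min_le_left T T')
  replace h' := h'.mono (min_le_right T T')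
  rcases ht.1.eq_or_lt with rfl | ht0
  · simp [h.z_zero, h'.z_zero, h.r_zero, h'.r_zero, h.theta_zero, h'.theta_zero]
  obtain ⟨ε, hε, hεT, heq⟩ := h.eqOn_short_time h' (ht0.trans_le ht.2)
  rcases le_total t ε with htε | htε
  · exact heq t ⟨ht.1, htε⟩
  · obtain ⟨h1, h2, h3⟩ := heq ε ⟨hε.le, le_rfl⟩
    exact h.eqOn_of_eq h' hε hεT h1 h2 h3 t ⟨htε, ht.2⟩

end IsCapOrbit

theorem HitsRAxisAtAngle.unique {c θ₁ θ₂ : ℝ} (h₁ : HitsRAxisAtAngle c θ₁)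
    (h₂ : HitsRAxisAtAngle c θ₂) : θ₁ = θ₂ := by
  obtain ⟨T, z, r, θ, hT, ho, hz, hzT, rfl⟩ := h₁
  obtain ⟨T', z', r', θ', hT', ho', hz', hzT', rfl⟩ := h₂
  have key := ho.unique ho'
  rcases lt_trichotomy T T' with hlt | rfl | hlt
  · have h1 := (key T ⟨hT.le, le_min le_rfl hlt.le⟩).1
    have h2 := hz' T ⟨hT.le, hlt⟩
    linarith
  · exact (key T ⟨hT.le, le_min le_rfl le_rfl⟩).2.2
  · have h1 := (key T' ⟨hT'.le, le_min hlt.le le_rfl⟩).1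
    have h2 := hz T' ⟨hT'.le, hlt⟩
    linarith

/-! ### The hitting angle as a local coordinate -/

/-- Near a point where the strict derivative is nonzero, a function expands distances. -/
theorem HasStrictDerivAt.exists_abs_sub_le {f : ℝ → ℝ} {d a : ℝ} (hf : HasStrictDerivAt f d a)
    (hd : d ≠ 0) : ∃ δ > 0, ∃ C > 0, ∀ x ∈ Set.Ioo (a - δ) (a + δ), ∀ y ∈ Set.Ioo (a - δ) (a + δ),
      |x - y| ≤ C * |f x - f y| := by
  have hd' : 0 < |d| := abs_pos.2 hd
  have h1 := hf.isLittleO.def (half_pos hd')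
  rw [Metric.eventually_nhds_iff] at h1
  obtain ⟨δ, hδ, h2⟩ := h1
  refine ⟨δ, hδ, 2 / |d|, by positivity, fun x hx y hy => ?_⟩
  rw [← Real.ball_eq_Ioo] at hx hy
  have h3 := @h2 (x, y) (by
    rw [Prod.dist_eq]
    exact max_lt hx hy)
  simp only [ContinuousLinearMap.toSpanSingleton_apply, smul_eq_mul, Real.norm_eq_abs] at h3
  have h4 : |d| * |x - y| ≤ |f x - f y| + |d| / 2 * |x - y| := by
    rw [← abs_mul]
    have h5 := abs_sub_abs_le_abs_sub (d * (x - y)) (f x - f y)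
    rw [abs_sub_comm (d * (x - y)), mul_comm d] at h5
    rw [mul_comm d]
    linarith
  rw [div_mul_eq_mul_div, le_div_iff₀ hd']
  linarith

/-- The angle at which the cap orbits near the round one hit the `r`-axis. -/
theorem exists_hitting_angle :
    ∃ (Θ : ℝ → ℝ) (d : ℝ), Θ (√2) = Real.pi ∧ d ≠ 0 ∧ HasStrictDerivAt Θ d (√2) ∧
      ∀ᶠ c in 𝓝 (√2), HitsRAxisAtAngle c (Θ c) := by
  obtain ⟨S, d, hS1, hd, hSd, hS⟩ := exists_profile_family
  have h2 : (√2) ^ 2 / 2 = (1 : ℝ) := by norm_num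
  have hq : HasStrictDerivAt (fun c : ℝ => c ^ 2 / 2) (√2) (√2) := by
    have := (hasStrictDerivAt_pow 2 (√2)).div_const 2
    refine this.congr_deriv ?_
    norm_num
  have hSd' : HasStrictDerivAt (fun c : ℝ => (S (c ^ 2 / 2)).1 1) (d * √2) (√2) := by
    rw [← h2] at hSd
    exact HasStrictDerivAt.comp (h₂ := fun b => (S b).1 1) (√2) hSd hq
  have h0 : (S ((√2) ^ 2 / 2)).1 1 = 0 := by rw [h2, hS1]; rfl
  refine ⟨fun c => Real.pi - Real.arctan ((S (c ^ 2 / 2)).1 1), -(d * √2), ?_, ?_, ?_, ?_⟩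
  · simp only [h0, Real.arctan_zero, sub_zero]
  · exact neg_ne_zero.2 (mul_ne_zero hd (by positivity))
  · have h3 := (Real.hasStrictDerivAt_arctan ((S ((√2) ^ 2 / 2)).1 1)).comp (√2) hSd'
    refine (h3.const_sub Real.pi).congr_deriv ?_
    rw [h0]
    norm_num
  · have h3 : Filter.Tendsto (fun c : ℝ => c ^ 2 / 2) (𝓝 (√2)) (𝓝 1) := by
      have h4 := hq.hasDerivAt.continuousAt.tendsto
      rwa [h2] at h4
    filter_upwards [h3.eventually hS, lt_mem_nhds (show 0 < √2 by positivity)] with c hc hc0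
    exact hitsRAxisAtAngle_of_profileMap hc0 hc.1 hc.2

theorem mainTheorem5 :
    ∃ δ₀ : ℝ, 0 < δ₀ ∧
      -- for every `c` near `√2` the orbit exists until it hits the `r`-axis, and it is unique
      (∀ c ∈ Set.Ioo (Real.sqrt 2 - δ₀) (Real.sqrt 2 + δ₀),
        (∃ θ₁ : ℝ, HitsRAxisAtAngle c θ₁) ∧
        (∀ (T T' : ℝ) (z r θ z' r' θ' : ℝ → ℝ),
          IsCapOrbit c T z r θ → IsCapOrbit c T' z' r' θ' →
          ∀ t ∈ Set.Icc 0 (min T T'), z t = z' t ∧ r t = r' t ∧ θ t = θ' t)) ∧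
      -- dependence of `c` on the angle
      ∃ C : ℝ, 0 < C ∧ ∀ δc : ℝ, 0 < δc → δc ≤ δ₀ →
        ∃ δθ : ℝ, 0 < δθ ∧
          ∀ θ₀ ∈ Set.Ioo (Real.pi - δθ) (Real.pi + δθ),
            ∃ c₀ ∈ Set.Ioo (Real.sqrt 2 - δc) (Real.sqrt 2 + δc),
              HitsRAxisAtAngle c₀ θ₀ ∧
              (∀ c ∈ Set.Ioo (Real.sqrt 2 - δc) (Real.sqrt 2 + δc),
                HitsRAxisAtAngle c θ₀ → c = c₀) ∧
              |c₀ - Real.sqrt 2| ≤ C * |θ₀ - Real.pi| := by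
  obtain ⟨Θ, d, hΘ, hd, hΘd, hhit⟩ := exists_hitting_angle
  obtain ⟨δ₁, hδ₁, C, hC, hlip⟩ := hΘd.exists_abs_sub_le hd
  obtain ⟨δ₂, hδ₂, hhit⟩ := Metric.eventually_nhds_iff_ball.1 hhit
  rw [Real.ball_eq_Ioo] at hhit
  have hsub : ∀ {δ δ' : ℝ}, δ ≤ δ' →
      Set.Ioo (√2 - δ) (√2 + δ) ⊆ Set.Ioo (√2 - δ') (√2 + δ') := fun h =>
    Set.Ioo_subset_Ioo (by linarith) (by linarith)
  refine ⟨min δ₁ δ₂, lt_min hδ₁ hδ₂, fun c hc => ⟨⟨Θ c, hhit c (hsub (min_le_right _ _) hc)⟩,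
    fun T T' z r θ z' r' θ' h h' => h.unique h'⟩, C, hC, fun δc hδc hδc₀ => ?_⟩
  -- A nonzero strict derivative makes Θ map neighbourhoods of √2 onto neighbourhoods of π; δθ
  -- depends on δc only through this, while C does not.
  have himg : Θ '' Set.Ioo (√2 - δc) (√2 + δc) ∈ 𝓝 Real.pi := by
    rw [← hΘ, ← hΘd.map_nhds_eq hd]
    exact Filter.image_mem_map (Ioo_mem_nhds (by linarith) (by linarith))
  obtain ⟨δθ, hδθ, hball⟩ := Metric.mem_nhds_iff.1 himg
  rw [Real.ball_eq_Ioo] at hball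
  refine ⟨δθ, hδθ, fun θ₀ hθ₀ => ?_⟩
  obtain ⟨c₀, hc₀, rfl⟩ := hball hθ₀
  have h1 := hsub (hδc₀.trans (min_le_left _ _))
  have h2 := hsub (hδc₀.trans (min_le_right _ _))
  refine ⟨c₀, hc₀, hhit c₀ (h2 hc₀), fun c hc h => ?_, ?_⟩
  · have h3 := hlip c (h1 hc) c₀ (h1 hc₀)
    rw [(hhit c (h2 hc)).unique h, sub_self, abs_zero, mul_zero, abs_nonpos_iff] at h3
    exact sub_eq_zero.1 h3
  · rw [← hΘ]
    exact hlip c₀ (h1 hc₀) _ ⟨by linarith, by linarith⟩
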